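/- Let $L$ be a frame, with bottom $0$ and top $1$, and let $a^*$ denote the pseudocomplement of $a\in L$. Let $\mathcal{R}L$ be the commutative ring of frame homomorphisms $\alpha:\mathcal{L}(\mathbb{R})\cong\mathfrak{O}\mathbb{R}\to L$, in which $$(\alpha\diamond\beta)(U)=\bigvee\{\alpha(V)\wedge\beta(W) : V,W\subseteq\mathbb{R}\text{ open},\ v\diamond w\in U\text{ for all } v\in V,\ w\in W\}\qquad(\diamond\in\{+,\cdot\}),$$ and in which the constant $\mathbf{r}$ ($r\in\mathbb{R}$) sends an open set $U$ to $1$ if $r\in U$ and to $0$ otherwise. Put $\operatorname{coz}\alpha=\alpha(-\infty,0)\vee\alpha(0,\infty)$ and $R_\alpha=\{r\in\mathbb{R} : \operatorname{coz}(\alpha-\mathbf{r})\neq 1\}$. Let $\mathcal{R}_cL$ be the subring of $\mathcal{R}L$ generated by $\{\alpha\in\mathcal{R}L : R_\alpha\text{ is countable}\}$; whenever this set is itself a subring, $\mathcal{R}_cL$ is equal to it. For $\alpha\in\mathcal{R}_cL$ let $P_\alpha$ be the intersection of all minimal prime ideals of $\mathcal{R}_cL$ that contain $\alpha$ (the whole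 ring if there are none). A proper ideal $Q$ of $\mathcal{R}_cL$ is a $d$-ideal if $P_\alpha\subseteq Q$ for every $\alpha\in Q$. An ideal $Q$ of $\mathcal{R}_cL$ is a $d_c$-ideal if, for all $\alpha\in\mathcal{R}_cL$ and $\beta\in Q$, the equality $(\operatorname{coz}\alpha)^*=(\operatorname{coz}\beta)^*$ implies $\alpha\in Q$. **Theorem.** Suppose that $L$ is zero-dimensional, that is, $a=\bigvee\{x\in L : x\vee x^*=1,\ x\le a\}$ for every $a\in L$. Then a proper ideal $Q$ of $\mathcal{R}_cL$ is a $d$-ideal if and only if it is a $d_c$-ideal. -/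

import Mathlib

open TopologicalSpace

namespace PointfreeRing

/-! ### The pairing of two frame homomorphisms out of frames of open sets -/

section Pairing

variable {X Y Z L : Type*} [TopologicalSpace X] [TopologicalSpace Y] [TopologicalSpace Z]
  [Order.Frame L]

/-- The open rectangle `V × W`. -/
def box (V : Opens X) (W : Opens Y) : Opens (X × Y) :=
  ⟨(V : Set X) ×ˢ (W : Set Y), V.isOpen.prod W.isOpen⟩

theorem mem_box {V : Opens X} {W : Opens Y} {z : X × Y} : z ∈ box V W ↔ z.1 ∈ V ∧ z.2 ∈ W :=
  Iff.rfl

/-- `U ↦ ⋁ {α V ∧ β W | V × W ⊆ U}`. -/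
def pairFun (α : FrameHom (Opens X) L) (β : FrameHom (Opens Y) L) (U : Opens (X × Y)) : L :=
  ⨆ (V : Opens X) (W : Opens Y) (_ : box V W ≤ U), α V ⊓ β W

theorem le_pairFun (α : FrameHom (Opens X) L) (β : FrameHom (Opens Y) L) {U : Opens (X × Y)}
    {V : Opens X} {W : Opens Y} (h : box V W ≤ U) : α V ⊓ β W ≤ pairFun α β U :=
  le_iSup_of_le V (le_iSup_of_le W (le_iSup_of_le h le_rfl))

theorem pairFun_le {α : FrameHom (Opens X) L} {β : FrameHom (Opens Y) L} {U : Opens (X × Y)}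
    {a : L} (h : ∀ V W, box V W ≤ U → α V ⊓ β W ≤ a) : pairFun α β U ≤ a :=
  iSup_le fun V => iSup_le fun W => iSup_le fun hVW => h V W hVW

theorem pairFun_mono (α : FrameHom (Opens X) L) (β : FrameHom (Opens Y) L) :
    Monotone (pairFun α β) :=
  fun _ _ h => pairFun_le fun _ _ hVW => le_pairFun α β (hVW.trans h)

theorem pairFun_inf (α : FrameHom (Opens X) L) (β : FrameHom (Opens Y) L)
    (U U' : Opens (X × Y)) :
    pairFun α β (U ⊓ U') = pairFun α β U ⊓ pairFun α β U' := by
  apply le_antisymm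
  · exact le_inf (pairFun_mono α β inf_le_left) (pairFun_mono α β inf_le_right)
  · rw [pairFun, iSup_inf_eq]
    refine iSup_le fun V => ?_
    rw [iSup_inf_eq]
    refine iSup_le fun W => ?_
    rw [iSup_inf_eq]
    refine iSup_le fun h => ?_
    rw [inf_comm, pairFun, iSup_inf_eq]
    refine iSup_le fun V' => ?_
    rw [iSup_inf_eq]
    refine iSup_le fun W' => ?_
    rw [iSup_inf_eq]
    refine iSup_le fun h' => ?_
    have hb : box (V ⊓ V') (W ⊓ W') ≤ U ⊓ U' := by
      intro z hz
      exact ⟨h ⟨hz.1.1, hz.2.1⟩, h' ⟨hz.1.2, hz.2.2⟩⟩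
    refine le_trans ?_ (le_pairFun α β hb)
    rw [map_inf, map_inf]
    refine le_inf (le_inf ?_ ?_) (le_inf ?_ ?_)
    · exact inf_le_right.trans inf_le_left
    · exact inf_le_left.trans inf_le_left
    · exact inf_le_right.trans inf_le_right
    · exact inf_le_left.trans inf_le_right

theorem pairFun_sSup [LocallyCompactSpace Y] (α : FrameHom (Opens X) L)
    (β : FrameHom (Opens Y) L) (S : Set (Opens (X × Y))) :
    pairFun α β (sSup S) = sSup (pairFun α β '' S) := by
  apply le_antisymm
  · set a := sSup (pairFun α β '' S) with ha
    refine pairFun_le fun V W hVW => ?_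
    -- the open sets contained in a compact subset of `W` cover `W`
    have hW : W = sSup {W' : Opens Y | ∃ K : Set Y, IsCompact K ∧ (W' : Set Y) ⊆ K ∧ K ⊆ W} := by
      apply le_antisymm
      · intro y hy
        obtain ⟨K, hK, hKW, hKc⟩ := local_compact_nhds (W.isOpen.mem_nhds hy)
        rw [Opens.mem_sSup]
        exact ⟨⟨interior K, isOpen_interior⟩, ⟨K, hKc, interior_subset, hKW⟩,
          mem_interior_iff_mem_nhds.2 hK⟩
      · refine sSup_le ?_
        rintro W' ⟨K, -, h1, h2⟩
        exact h1.trans h2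
    rw [hW, map_sSup, inf_sSup_eq]
    refine iSup₂_le ?_
    rintro _ ⟨W', ⟨K, hKc, hW'K, hKW⟩, rfl⟩
    -- around each point of `V` there is a neighbourhood on which the bound holds
    have key : ∀ x ∈ V, ∃ N : Opens X, x ∈ N ∧ ∃ M : Opens Y, K ⊆ M ∧ α N ⊓ β M ≤ a := by
      intro x hx
      refine hKc.induction_on (p := fun K' => ∃ N : Opens X, x ∈ N ∧ ∃ M : Opens Y,
        K' ⊆ M ∧ α N ⊓ β M ≤ a) ?_ ?_ ?_ ?_
      · exact ⟨⊤, trivial, ⊥, Set.empty_subset _, by simp⟩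
      · rintro s t hst ⟨N, hN, M, hM, h⟩
        exact ⟨N, hN, M, hst.trans hM, h⟩
      · rintro s t ⟨N, hN, M, hM, h⟩ ⟨N', hN', M', hM', h'⟩
        refine ⟨N ⊓ N', ⟨hN, hN'⟩, M ⊔ M', ?_, ?_⟩
        · rw [Opens.coe_sup]
          exact Set.union_subset_union hM hM'
        · rw [map_sup, inf_sup_left]
          refine sup_le (le_trans ?_ h) (le_trans ?_ h')
          · exact inf_le_inf_right _ (OrderHomClass.mono α inf_le_left)
          · exact inf_le_inf_right _ (OrderHomClass.mono α inf_le_right)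
      · intro y hy
        have hxy : (x, y) ∈ sSup S := hVW ⟨hx, hKW hy⟩
        rw [Opens.mem_sSup] at hxy
        obtain ⟨U, hU, hxyU⟩ := hxy
        obtain ⟨N, M, hNo, hMo, hxN, hyM, hNM⟩ := isOpen_prod_iff.1 U.isOpen x y hxyU
        refine ⟨M, mem_nhdsWithin_of_mem_nhds (hMo.mem_nhds hyM), ⟨N, hNo⟩, hxN, ⟨M, hMo⟩,
          subset_rfl, ?_⟩
        have hb : box (⟨N, hNo⟩ : Opens X) (⟨M, hMo⟩ : Opens Y) ≤ U := hNM
        exact (le_pairFun α β hb).trans (le_sSup ⟨U, hU, rfl⟩)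
    have hV : V ≤ sSup {N : Opens X | α N ⊓ β W' ≤ a} := by
      intro x hx
      obtain ⟨N, hN, M, hKM, h⟩ := key x hx
      rw [Opens.mem_sSup]
      refine ⟨N, le_trans (inf_le_inf_left _ (OrderHomClass.mono β ?_)) h, hN⟩
      exact hW'K.trans hKM
    refine (inf_le_inf_right _ (OrderHomClass.mono α hV)).trans ?_
    rw [map_sSup, sSup_inf_eq]
    refine iSup₂_le ?_
    rintro _ ⟨N, hN, rfl⟩
    exact hN
  · refine sSup_le ?_
    rintro _ ⟨U, hU, rfl⟩
    exact pairFun_mono α β (le_sSup hU)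

/-- The frame homomorphism out of `𝔒(X × Y)` induced by two frame homomorphisms out of `𝔒 X`
and `𝔒 Y`, for a locally compact space `Y` (in this case `𝔒(X × Y)` is the coproduct of `𝔒 X` and
`𝔒 Y` in the category of frames). -/
def pairing [LocallyCompactSpace Y] (α : FrameHom (Opens X) L) (β : FrameHom (Opens Y) L) :
    FrameHom (Opens (X × Y)) L where
  toFun := pairFun α β
  map_inf' := pairFun_inf α β
  map_top' := by
    apply top_le_iff.1
    have : box (⊤ : Opens X) (⊤ : Opens Y) ≤ ⊤ := le_top
    simpa using le_pairFun α β this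
  map_sSup' := pairFun_sSup α β

theorem pairing_apply [LocallyCompactSpace Y] (α : FrameHom (Opens X) L)
    (β : FrameHom (Opens Y) L) (U : Opens (X × Y)) :
    pairing α β U = ⨆ (V : Opens X) (W : Opens Y) (_ : box V W ≤ U), α V ⊓ β W := rfl

theorem pairing_comp_fst [LocallyCompactSpace Y] (α : FrameHom (Opens X) L)
    (β : FrameHom (Opens Y) L) :
    (pairing α β).comp (Opens.comap ContinuousMap.fst) = α := by
  refine FrameHom.ext fun V => le_antisymm ?_ ?_
  · refine pairFun_le fun V' W' h => ?_
    by_cases hW : W' = ⊥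
    · simp [hW]
    · obtain ⟨y, hy⟩ := (Opens.ne_bot_iff_nonempty W').1 hW
      refine inf_le_left.trans (OrderHomClass.mono α fun x hx => ?_)
      exact h (show (x, y) ∈ box V' W' from ⟨hx, hy⟩)
  · have : box V (⊤ : Opens Y) ≤ Opens.comap ContinuousMap.fst V := fun z hz => hz.1
    have h : α V ≤ α V ⊓ β ⊤ := by simp
    exact h.trans (le_pairFun α β this)

theorem pairing_comp_snd [LocallyCompactSpace Y] (α : FrameHom (Opens X) L)
    (β : FrameHom (Opens Y) L) :
    (pairing α β).comp (Opens.comap ContinuousMap.snd) = β := by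
  refine FrameHom.ext fun W => le_antisymm ?_ ?_
  · refine pairFun_le fun V' W' h => ?_
    by_cases hV : V' = ⊥
    · simp [hV]
    · obtain ⟨x, hx⟩ := (Opens.ne_bot_iff_nonempty V').1 hV
      refine inf_le_right.trans (OrderHomClass.mono β fun y hy => ?_)
      exact h (show (x, y) ∈ box V' W' from ⟨hx, hy⟩)
  · have : box (⊤ : Opens X) W ≤ Opens.comap ContinuousMap.snd W := fun z hz => hz.2
    have h : β W ≤ α ⊤ ⊓ β W := by simp
    exact h.trans (le_pairFun α β this)

/-- A frame homomorphism out of `𝔒(X × Y)` is determined by its two components. -/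
theorem pairing_unique [LocallyCompactSpace Y] (h : FrameHom (Opens (X × Y)) L) :
    pairing (h.comp (Opens.comap ContinuousMap.fst)) (h.comp (Opens.comap ContinuousMap.snd))
      = h := by
  have hbox : ∀ (V : Opens X) (W : Opens Y),
      h (Opens.comap ContinuousMap.fst V) ⊓ h (Opens.comap ContinuousMap.snd W) = h (box V W) := by
    intro V W
    rw [← map_inf]
    rfl
  refine FrameHom.ext fun U => le_antisymm ?_ ?_
  · refine pairFun_le fun V W hVW => ?_
    exact (hbox V W).le.trans (OrderHomClass.mono h hVW)
  · have hU : U ≤ sSup {B | ∃ (V : Opens X) (W : Opens Y), B = box V W ∧ box V W ≤ U} := by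
      rintro ⟨x, y⟩ hxy
      obtain ⟨N, M, hNo, hMo, hxN, hyM, hNM⟩ := isOpen_prod_iff.1 U.isOpen x y hxy
      rw [Opens.mem_sSup]
      exact ⟨_, ⟨⟨N, hNo⟩, ⟨M, hMo⟩, rfl, hNM⟩, ⟨hxN, hyM⟩⟩
    refine (OrderHomClass.mono h hU).trans ?_
    rw [map_sSup]
    refine sSup_le ?_
    rintro _ ⟨_, ⟨V, W, rfl, hVW⟩, rfl⟩
    rw [← hbox V W]
    exact le_pairFun (h.comp (Opens.comap ContinuousMap.fst))
      (h.comp (Opens.comap ContinuousMap.snd)) hVW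

end Pairing

/-! ### The ring of continuous real-valued functions on a frame -/

/-- `ℛL`: the frame homomorphisms from the frame of reals (the frame of open subsets of `ℝ`)
to `L`. -/
def RL (L : Type*) [Order.Frame L] : Type _ := FrameHom (Opens ℝ) L

namespace RL

variable {L : Type*} [Order.Frame L]

instance : FunLike (RL L) (Opens ℝ) L := inferInstanceAs (FunLike (FrameHom (Opens ℝ) L) _ _)

instance : FrameHomClass (RL L) (Opens ℝ) L :=
  inferInstanceAs (FrameHomClass (FrameHom (Opens ℝ) L) _ _)

/-- The underlying frame homomorphism. -/
def toHom (α : RL L) : FrameHom (Opens ℝ) L := α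

/-- For a continuous `f : ℝ × ℝ → ℝ`, the element `f(α, β)` of `ℛL`. Its value at an open set `U`
is `⋁ {α V ∧ β W | f(V × W) ⊆ U}`. -/
def lift₂ (f : C(ℝ × ℝ, ℝ)) (α β : RL L) : RL L :=
  (pairing α.toHom β.toHom).comp (Opens.comap f)

/-- The constant function `r`: an open set goes to `1` if it contains `r`, and to `0` otherwise. -/
def const (r : ℝ) : RL L where
  toFun U := ⨆ _ : r ∈ U, ⊤
  map_inf' U V := by
    by_cases hU : r ∈ U <;> by_cases hV : r ∈ V <;> simp [hU, hV, Opens.mem_inf]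
  map_top' := by simp
  map_sSup' S := by
    apply le_antisymm
    · refine iSup_le fun h => ?_
      obtain ⟨U, hU, hr⟩ := Opens.mem_sSup.1 h
      exact le_sSup_of_le ⟨U, hU, rfl⟩ (le_iSup_of_le hr le_rfl)
    · refine sSup_le ?_
      rintro _ ⟨U, hU, rfl⟩
      exact iSup_le fun hr => le_iSup_of_le (Opens.mem_sSup.2 ⟨U, hU, hr⟩) le_rfl

instance : Add (RL L) := ⟨lift₂ ⟨fun z => z.1 + z.2, by fun_prop⟩⟩
instance : Mul (RL L) := ⟨lift₂ ⟨fun z => z.1 * z.2, by fun_prop⟩⟩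
instance : Neg (RL L) := ⟨fun α => α.toHom.comp (Opens.comap ⟨fun x : ℝ => -x, by fun_prop⟩)⟩
instance : Zero (RL L) := ⟨const 0⟩
instance : One (RL L) := ⟨const 1⟩

/-- A frame homomorphism `h : 𝔒 X → L` sends continuous functions on `X` to elements of `ℛL`. -/
def push {X : Type*} [TopologicalSpace X] (h : FrameHom (Opens X) L) (f : C(X, ℝ)) : RL L :=
  h.comp (Opens.comap f)

section push

variable {X : Type*} [TopologicalSpace X] (h : FrameHom (Opens X) L) (f g : C(X, ℝ))

theorem lift₂_push (k : C(ℝ × ℝ, ℝ)) :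
    lift₂ k (push h f) (push h g) = push h (k.comp (f.prodMk g)) := by
  have := pairing_unique (h.comp (Opens.comap (f.prodMk g)))
  exact congrArg (fun m : FrameHom (Opens (ℝ × ℝ)) L => m.comp (Opens.comap k)) this

theorem push_add : push h f + push h g = push h (f + g) := lift₂_push h f g _
theorem push_mul : push h f * push h g = push h (f * g) := lift₂_push h f g _
theorem push_neg : -push h f = push h (-f) := rfl

theorem push_const (r : ℝ) : push h (ContinuousMap.const X r) = const r := by
  refine FrameHom.ext fun U => ?_
  change h (Opens.comap _ U) = ⨆ _ : r ∈ U, ⊤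
  by_cases hr : r ∈ U
  · have : Opens.comap (ContinuousMap.const X r) U = ⊤ := by
      ext x; simpa using hr
    simp [this, hr]
  · have : Opens.comap (ContinuousMap.const X r) U = ⊥ := by
      ext x; simpa using hr
    simp [this, hr]

theorem push_zero : push h 0 = 0 := push_const h 0
theorem push_one : push h 1 = 1 := push_const h 1

end push

theorem exists_push (α β γ : RL L) : ∃ (h : FrameHom (Opens (ℝ × (ℝ × ℝ))) L)
    (f g k : C(ℝ × (ℝ × ℝ), ℝ)), α = push h f ∧ β = push h g ∧ γ = push h k := by
  refine ⟨pairing α.toHom (pairing β.toHom γ.toHom), ContinuousMap.fst,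
    ContinuousMap.fst.comp ContinuousMap.snd, ContinuousMap.snd.comp ContinuousMap.snd,
    (pairing_comp_fst _ _).symm, ?_, ?_⟩
  · have := congrArg (fun m : FrameHom (Opens (ℝ × ℝ)) L => m.comp (Opens.comap ContinuousMap.fst))
      (pairing_comp_snd α.toHom (pairing β.toHom γ.toHom))
    exact ((this.trans (pairing_comp_fst β.toHom γ.toHom))).symm
  · have := congrArg (fun m : FrameHom (Opens (ℝ × ℝ)) L => m.comp (Opens.comap ContinuousMap.snd))
      (pairing_comp_snd α.toHom (pairing β.toHom γ.toHom))
    exact ((this.trans (pairing_comp_snd β.toHom γ.toHom))).symm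

instance : CommRing (RL L) where
  add_assoc α β γ := by
    obtain ⟨h, f, g, k, rfl, rfl, rfl⟩ := exists_push α β γ
    simp only [push_add, add_assoc]
  zero_add α := by
    obtain ⟨h, f, g, k, rfl, -, -⟩ := exists_push α α α
    rw [← push_zero h, push_add, zero_add]
  add_zero α := by
    obtain ⟨h, f, g, k, rfl, -, -⟩ := exists_push α α α
    rw [← push_zero h, push_add, add_zero]
  add_comm α β := by
    obtain ⟨h, f, g, k, rfl, rfl, -⟩ := exists_push α β β
    rw [push_add, push_add, add_comm]
  neg_add_cancel α := by
    obtain ⟨h, f, g, k, rfl, -, -⟩ := exists_push α α α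
    rw [push_neg, push_add, neg_add_cancel, push_zero]
  left_distrib α β γ := by
    obtain ⟨h, f, g, k, rfl, rfl, rfl⟩ := exists_push α β γ
    simp only [push_add, push_mul, mul_add]
  right_distrib α β γ := by
    obtain ⟨h, f, g, k, rfl, rfl, rfl⟩ := exists_push α β γ
    simp only [push_add, push_mul, add_mul]
  zero_mul α := by
    obtain ⟨h, f, g, k, rfl, -, -⟩ := exists_push α α α
    rw [← push_zero h, push_mul, zero_mul]
  mul_zero α := by
    obtain ⟨h, f, g, k, rfl, -, -⟩ := exists_push α α α
    rw [← push_zero h, push_mul, mul_zero]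
  mul_assoc α β γ := by
    obtain ⟨h, f, g, k, rfl, rfl, rfl⟩ := exists_push α β γ
    simp only [push_mul, mul_assoc]
  one_mul α := by
    obtain ⟨h, f, g, k, rfl, -, -⟩ := exists_push α α α
    rw [← push_one h, push_mul, one_mul]
  mul_one α := by
    obtain ⟨h, f, g, k, rfl, -, -⟩ := exists_push α α α
    rw [← push_one h, push_mul, mul_one]
  mul_comm α β := by
    obtain ⟨h, f, g, k, rfl, rfl, -⟩ := exists_push α β β
    rw [push_mul, push_mul, mul_comm]
  nsmul := nsmulRec
  zsmul := zsmulRec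

/-- The cozero element `coz α = α(-,0) ∨ α(0,-)`. -/
def coz (α : RL L) : L :=
  α ⟨Set.Iio (0 : ℝ), isOpen_Iio⟩ ⊔ α ⟨Set.Ioi (0 : ℝ), isOpen_Ioi⟩

/-- The pointfree image `R_α = {r ∈ ℝ | coz(α - r) ≠ 1}`. -/
def image (α : RL L) : Set ℝ := {r | coz (α - const r) ≠ ⊤}

end RL

/-- The set of elements of `ℛL` that have a countable pointfree image. -/
def countableImage (L : Type*) [Order.Frame L] : Set (RL L) := {α | α.image.Countable}

/-- The ring `ℛ_cL`: the subring of `ℛL` of the elements with a countable pointfree image.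
For some frames the set of these elements is not closed under addition, so the subring is defined
as the one that this set generates. It is equal to the set itself whenever the set is a subring, see
`coe_RcL_of_subring`. -/
def RcL (L : Type*) [Order.Frame L] : Subring (RL L) := Subring.closure (countableImage L)

theorem countableImage_subset_RcL (L : Type*) [Order.Frame L] :
    countableImage L ⊆ (RcL L : Set (RL L)) :=
  Subring.subset_closure

theorem coe_RcL_of_subring {L : Type*} [Order.Frame L] (A : Subring (RL L))
    (hA : (A : Set (RL L)) = countableImage L) : (RcL L : Set (RL L)) = countableImage L := by
  rw [RcL, ← hA, Subring.closure_eq]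

/-- A frame is zero-dimensional if every element is the join of the complemented elements
below it, where `x` is complemented if `x ∨ x* = 1`. -/
def IsZeroDimensional (L : Type*) [Order.Frame L] : Prop :=
  ∀ a : L, a = sSup {x | x ⊔ xᶜ = ⊤ ∧ x ≤ a}

/-- `P_α`: the intersection of all the minimal prime ideals that contain `α`
(the whole ring if there are none). -/
def minimalPrimeHull {R : Type*} [CommRing R] (α : R) : Ideal R :=
  sInf {p | p ∈ minimalPrimes R ∧ α ∈ p}

/-- A proper ideal `Q` is a `d`-ideal if `P_α ⊆ Q` for every `α ∈ Q`. -/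
def IsDIdeal {R : Type*} [CommRing R] (Q : Ideal R) : Prop :=
  Q ≠ ⊤ ∧ ∀ α ∈ Q, minimalPrimeHull α ≤ Q

/-- An ideal `Q` of `ℛ_cL` is a `d_c`-ideal if it contains every `α ∈ ℛ_cL` for which
`(coz α)* = (coz β)*` for some `β ∈ Q`. -/
def IsDcIdeal {L : Type*} [Order.Frame L] (Q : Ideal (RcL L)) : Prop :=
  ∀ α : RcL L, ∀ β ∈ Q, (α : RL L).cozᶜ = (β : RL L).cozᶜ → α ∈ Q

end PointfreeRing

/-! ### Minimal primes of reduced rings -/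

namespace PointfreeRing

/-! In a reduced ring `P_α` is the double annihilator of `α` (`mem_minimalPrimeHull_iff`). In
`ℛ_cL`, a product vanishes exactly when the cozero elements are disjoint. Over a zero-dimensional
frame, characteristic functions of complemented elements provide enough annihilators to recover
`(coz α)*`. Hence `β ∈ P_α` iff `(coz α)* ≤ (coz β)*` (`mem_minimalPrimeHull_iff_compl_coz_le`).

So a `d`-ideal is a `d_c`-ideal at once. Conversely, let `β ∈ Q` and `α ∈ P_β`. Then `coz α ≤ (coz
β)**`, so `αβ ∈ Q` has the same `(coz)*` as `α`, and the `d_c`-condition puts `α` in `Q`. -/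

/-- If the monoid generated by `α` and the complement of `p` missed `0`, a prime disjoint from it
would lie in `p` and omit `α`, against minimality. -/
theorem exists_notMem_mul_eq_zero_of_mem_minimalPrimes {R : Type*} [CommRing R] [IsReduced R]
    {p : Ideal R} (hp : p ∈ minimalPrimes R) {α : R} (hα : α ∈ p) : ∃ γ ∉ p, α * γ = 0 := by
  have hprime : p.IsPrime := hp.1.1
  by_cases h0 : (0 : R) ∈ Submonoid.powers α ⊔ p.primeCompl
  · obtain ⟨_, ⟨n, rfl⟩, γ, hγ, h⟩ := Submonoid.mem_sup.1 h0
    -- Here `α ^ n * γ = 0`; the exponent `n + 1` leaves this factor intact even for `n = 0`.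
    refine ⟨γ, hγ, eq_zero_of_pow_eq_zero (n := n + 1) ?_⟩
    calc (α * γ) ^ (n + 1) = α ^ n * γ * (α * γ ^ n) := by ring
      _ = 0 := by rw [h, zero_mul]
  · obtain ⟨q, hq, -, hd⟩ := Ideal.exists_le_prime_disjoint (⊥ : Ideal R)
      (Submonoid.powers α ⊔ p.primeCompl) (by simpa using h0)
    have hqp : q ≤ p := fun x hx => by_contra fun hxp =>
      Set.disjoint_left.1 hd hx ((le_sup_right : p.primeCompl ≤ _) hxp)
    exact absurd ((le_sup_left : Submonoid.powers α ≤ _) (Submonoid.mem_powers α))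
      (Set.disjoint_left.1 hd (hp.2 ⟨hq, bot_le⟩ hqp hα))

/-- In a reduced ring, `P_α` consists of the elements annihilated by the annihilator of `α`. -/
theorem mem_minimalPrimeHull_iff {R : Type*} [CommRing R] [IsReduced R] {α β : R} :
    β ∈ minimalPrimeHull α ↔ ∀ γ, α * γ = 0 → β * γ = 0 := by
  constructor
  · intro h γ hγ
    -- The intersection of the minimal primes is the nilradical, which is zero here.
    have hn : β * γ ∈ sInf (minimalPrimes R) := by
      refine Submodule.mem_sInf.2 fun (p : Ideal R) hp => ?_
      have hprime : p.IsPrime := hp.1.1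
      rcases hprime.mem_or_mem (show α * γ ∈ p from hγ ▸ p.zero_mem) with hα | hγp
      · exact p.mul_mem_right _ (Submodule.mem_sInf.1 h p ⟨hp, hα⟩)
      · exact p.mul_mem_left _ hγp
    rw [minimalPrimes, Ideal.sInf_minimalPrimes] at hn
    exact IsNilpotent.eq_zero (mem_nilradical.1 hn)
  · intro h
    refine Submodule.mem_sInf.2 fun (p : Ideal R) hp => ?_
    have hprime : p.IsPrime := hp.1.1.1
    obtain ⟨γ, hγ, h0⟩ := exists_notMem_mul_eq_zero_of_mem_minimalPrimes hp.1 hp.2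
    have hβ : β * γ ∈ p := h γ h0 ▸ p.zero_mem
    exact (hprime.mem_or_mem hβ).resolve_right hγ

/-! ### Cozero elements and characteristic functions -/

namespace RL

variable {L : Type*} [Order.Frame L]

/-- With `exists_push`, this reduces identities between cozero elements to pointwise facts about
real functions. -/
theorem coz_push {X : Type*} [TopologicalSpace X] (h : FrameHom (Opens X) L) (f : C(X, ℝ)) :
    (push h f).coz = h ⟨{x | f x ≠ 0}, isOpen_ne.preimage f.continuous⟩ := by
  change h _ ⊔ h _ = _
  rw [← map_sup]
  congr 1
  ext x
  exact lt_or_lt_iff_ne (a := f x) (b := 0)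

theorem coz_mul (α β : RL L) : (α * β).coz = α.coz ⊓ β.coz := by
  obtain ⟨h, f, g, -, rfl, rfl, -⟩ := exists_push α β β
  rw [push_mul, coz_push, coz_push, coz_push, ← map_inf]
  congr 1
  ext x
  exact mul_ne_zero_iff

theorem coz_eq_bot_iff {α : RL L} : α.coz = ⊥ ↔ α = 0 := by
  constructor
  · intro h
    -- `α` is the push of the identity of `ℝ` along itself.
    have hα : α ⟨{x : ℝ | x ≠ 0}, isOpen_ne⟩ = ⊥ := (coz_push α.toHom (.id ℝ)).symm.trans h
    refine FrameHom.ext fun U => ?_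
    change α U = ⨆ _ : (0 : ℝ) ∈ U, ⊤
    by_cases hU : (0 : ℝ) ∈ U
    · have htop : U ⊔ ⟨{x : ℝ | x ≠ 0}, isOpen_ne⟩ = ⊤ := by
        refine top_le_iff.1 fun x _ => ?_
        by_cases hx : x = 0
        · exact Or.inl (hx ▸ hU)
        · exact Or.inr hx
      have := congrArg α htop
      rw [map_sup, hα, map_top, sup_bot_eq] at this
      simp [this, hU]
    · have hle : U ≤ ⟨{x : ℝ | x ≠ 0}, isOpen_ne⟩ := fun x hx h0 => hU (h0 ▸ hx)
      have := (OrderHomClass.mono α hle).trans hα.le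
      simpa [hU] using this
  · rintro rfl
    change (⨆ _ : (0 : ℝ) < 0, ⊤) ⊔ (⨆ _ : (0 : ℝ) < 0, ⊤) = (⊥ : L)
    simp

theorem mul_eq_zero_iff_disjoint {α β : RL L} : α * β = 0 ↔ Disjoint α.coz β.coz := by
  rw [← coz_eq_bot_iff, coz_mul, disjoint_iff]

instance : IsReduced (RL L) := by
  refine (isReduced_iff_pow_one_lt 2 one_lt_two).2 fun α h => ?_
  rw [pow_two, ← coz_eq_bot_iff, coz_mul, inf_idem] at h
  exact coz_eq_bot_iff.1 h

/-- The frame homomorphism out of the discrete two-point space that a complemented element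
defines. -/
def boolHom (x : L) (hx : x ⊔ xᶜ = ⊤) : FrameHom (Opens Bool) L where
  toFun U := (⨆ _ : true ∈ U, x) ⊔ ⨆ _ : false ∈ U, xᶜ
  map_inf' U V := by
    by_cases h1 : true ∈ U <;> by_cases h2 : true ∈ V <;> by_cases h3 : false ∈ U <;>
      by_cases h4 : false ∈ V <;> simp [h1, h2, h3, h4, Opens.mem_inf, hx]
  map_top' := by simpa using hx
  map_sSup' S := by
    apply le_antisymm
    · refine sup_le (iSup_le fun h => ?_) (iSup_le fun h => ?_) <;>
        obtain ⟨U, hU, hr⟩ := Opens.mem_sSup.1 h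
      · exact le_sSup_of_le ⟨U, hU, rfl⟩ (le_sup_of_le_left (le_iSup_of_le hr le_rfl))
      · exact le_sSup_of_le ⟨U, hU, rfl⟩ (le_sup_of_le_right (le_iSup_of_le hr le_rfl))
    · refine sSup_le ?_
      rintro _ ⟨U, hU, rfl⟩
      exact sup_le_sup
        (iSup_le fun hr => le_iSup_of_le (Opens.mem_sSup.2 ⟨U, hU, hr⟩) le_rfl)
        (iSup_le fun hr => le_iSup_of_le (Opens.mem_sSup.2 ⟨U, hU, hr⟩) le_rfl)

/-- The characteristic function of a complemented element. -/
def indicator (x : L) (hx : x ⊔ xᶜ = ⊤) : RL L :=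
  push (boolHom x hx) ⟨fun b => cond b 1 0, continuous_of_discreteTopology⟩

theorem coz_indicator (x : L) (hx : x ⊔ xᶜ = ⊤) : (indicator x hx).coz = x := by
  rw [indicator, coz_push]
  change (⨆ _ : (1 : ℝ) ≠ 0, x) ⊔ (⨆ _ : (0 : ℝ) ≠ 0, xᶜ) = x
  simp

/-- For `r` other than `0` and `1`, the function minus `r` is nonzero at both points of `Bool`, so
its cozero element is `x ⊔ xᶜ`. -/
theorem image_indicator_subset (x : L) (hx : x ⊔ xᶜ = ⊤) : (indicator x hx).image ⊆ {0, 1} := by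
  intro r hr
  by_contra hr'
  rw [Set.mem_insert_iff, Set.mem_singleton_iff, not_or] at hr'
  apply hr
  rw [indicator, ← push_const (boolHom x hx), sub_eq_add_neg, push_neg, push_add, coz_push]
  change (⨆ _ : (1 : ℝ) + -r ≠ 0, x) ⊔ (⨆ _ : (0 : ℝ) + -r ≠ 0, xᶜ) = ⊤
  have h1 : (1 : ℝ) + -r ≠ 0 := fun h => hr'.2 (by linarith)
  have h0 : (0 : ℝ) + -r ≠ 0 := fun h => hr'.1 (by linarith)
  simpa only [h1, h0, ne_eq, not_false_eq_true, iSup_pos] using hx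

theorem indicator_mem_RcL (x : L) (hx : x ⊔ xᶜ = ⊤) : indicator x hx ∈ RcL L :=
  countableImage_subset_RcL L
    (((Set.countable_singleton (1 : ℝ)).insert 0).mono (image_indicator_subset x hx))

end RL

/-! ### Annihilators in `ℛ_cL` and pseudocomplements -/

section RcL

variable {L : Type*} [Order.Frame L]

instance : IsReduced (RcL L) :=
  isReduced_of_injective (RcL L).subtype Subtype.val_injective

theorem RcL.mul_eq_zero_iff {α β : RcL L} :
    α * β = 0 ↔ Disjoint (α : RL L).coz (β : RL L).coz := by
  rw [← RL.mul_eq_zero_iff_disjoint, ← Subring.coe_mul, ZeroMemClass.coe_eq_zero]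

/-- Over a zero-dimensional frame, membership in `P_α` only depends on pseudocomplements of
cozero elements. -/
theorem mem_minimalPrimeHull_iff_compl_coz_le (hL : IsZeroDimensional L) {α β : RcL L} :
    β ∈ minimalPrimeHull α ↔ (α : RL L).cozᶜ ≤ (β : RL L).cozᶜ := by
  rw [mem_minimalPrimeHull_iff]
  simp only [RcL.mul_eq_zero_iff]
  constructor
  · intro h
    -- It suffices to bound the complemented `x` below `(coz α)*`: the characteristic function of
    -- `x` annihilates `α`, hence `β`, so `x` is disjoint from `coz β`.
    rw [hL (α : RL L).cozᶜ]
    refine sSup_le ?_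
    rintro x ⟨hx, hxα⟩
    have := h ⟨RL.indicator x hx, RL.indicator_mem_RcL x hx⟩
    simp only [RL.coz_indicator] at this
    exact (this (le_compl_iff_disjoint_left.1 hxα)).le_compl_left
  · intro h γ hγ
    exact le_compl_iff_disjoint_left.1 ((le_compl_iff_disjoint_left.2 hγ).trans h)

end RcL

end PointfreeRing

open PointfreeRing in
theorem theorem3p11 {L : Type*} [Order.Frame L] (hL : PointfreeRing.IsZeroDimensional L)
    (Q : Ideal (PointfreeRing.RcL L)) (hQ : Q ≠ ⊤) :
    PointfreeRing.IsDIdeal Q ↔ PointfreeRing.IsDcIdeal Q := by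
  constructor
  · rintro ⟨-, h⟩ α β hβ hαβ
    exact h β hβ ((mem_minimalPrimeHull_iff_compl_coz_le hL).2 hαβ.ge)
  · refine fun h => ⟨hQ, fun β hβ α hα => ?_⟩
    have hle := (mem_minimalPrimeHull_iff_compl_coz_le hL).1 hα
    -- Only an inequality with `(coz β)*` is known, so `α` is compared with `α * β` instead of `β`.
    refine h α (α * β) (Q.mul_mem_left α hβ) ?_
    rw [Subring.coe_mul, RL.coz_mul]
    refine le_antisymm (compl_anti inf_le_left) ?_
    -- Double pseudocomplementation preserves binary meets, and `hle` gives `(coz α)** ≤ (coz β)**`.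
    have hcc : ((α : RL L).coz)ᶜᶜ ≤ ((α : RL L).coz ⊓ (β : RL L).coz)ᶜᶜ := by
      rw [compl_compl_inf_distrib]
      exact le_inf le_rfl (compl_anti hle)
    simpa only [compl_compl_compl] using compl_anti hcc
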